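/- Let $K$ be a field of characteristic zero, and let $\mathbb{I}_1 = K\langle x, \frac{d}{dx}, \int\rangle$ be the algebra of polynomial integro-differential operators, that is, the $K$-subalgebra of $\operatorname{End}_K(K[x])$ generated by multiplication by $x$, the derivation $\partial=\frac{d}{dx}$ and the integration $\int\colon x^n\mapsto \frac{x^{n+1}}{n+1}$ $(n\ge 0)$. Let $F\subseteq\mathbb{I}_1$ be the $K$-linear span of the elements $e_{ij}=\int^i\partial^j-\int^{i+1}\partial^{j+1}$, $i,j\ge 0$ (it is a two-sided ideal of $\mathbb{I}_1$). 1. Every finitely generated left (resp. right) ideal of $\mathbb{I}_1$ is generated by two elements. 2. Let $I$ be a left (resp. right) ideal of $\mathbb{I}_1$. (a) If $I\not\subseteq F$, then the left (resp. right) ideal $I$ is generated by two elements (no finite generation being assumed). (b) If $I\subseteq F$ and $I$ is a finitely generated left (resp. right) ideal, then $I$ is generated by a single element. -/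

import Mathlib

open Polynomial

noncomputable section

namespace IntegroDiff

variable (K : Type*) [Field K]

/-- Integration on `K[x]`: the `K`-linear map with `x ^ n ↦ x ^ (n + 1) / (n + 1)`. -/
def integration : Module.End K K[X] :=
  Polynomial.lsum fun n : ℕ => ((n : K) + 1)⁻¹ • Polynomial.monomial (n + 1)

/-- The algebra of polynomial integro-differential operators: the subalgebra of `End_K(K[x])`
generated by multiplication by `x`, the derivation `d/dx` and integration. -/
def I1 : Subalgebra K (Module.End K K[X]) :=
  Algebra.adjoin K {LinearMap.mulLeft K (X : K[X]), Polynomial.derivative, integration K}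

/-- The derivation `d/dx`, as an element of the algebra. -/
def der : I1 K :=
  ⟨Polynomial.derivative, Algebra.subset_adjoin (by simp)⟩

/-- Integration, as an element of the algebra. -/
def integ : I1 K :=
  ⟨integration K, Algebra.subset_adjoin (by simp)⟩

/-- The element `e i j = ∫ ^ i ∂ ^ j - ∫ ^ (i + 1) ∂ ^ (j + 1)`. -/
def e (i j : ℕ) : I1 K :=
  integ K ^ i * der K ^ j - integ K ^ (i + 1) * der K ^ (j + 1)

/-- The ideal `F`, as a set: the `K`-linear span of the elements `e i j`. -/
def F : Submodule K (I1 K) :=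
  Submodule.span K (Set.range fun p : ℕ × ℕ => e K p.1 p.2)

end IntegroDiff

end

/-! Write S = ∫, T = ∂, H = ∂x. The argument uses only TS = 1, SHT = H - 1, generation by S, T, H,
and 1 ∉ F. These conditions survive reversing the multiplication and exchanging S with T, so right
ideals follow from left ones.

Modulo F the element T becomes invertible, and the quotient is a skew Laurent polynomial ring over
K[H]. A two-sided ideal containing a nonzero polynomial in T over K[H] contains 1
(`one_mem_of_sum_mem`).

Let a ∈ I \ F. The module R/Ra has a filtration of at most linear growth
(`exists_finrank_level_le`). A nonzero subquotient grows at least linearly, because a trace argument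
excludes nonzero finite-dimensional modules (`eq_bot_of_stable`). Comparing slopes bounds the length
of chains, so R/Ra has finite length (`isFiniteLength`). As R/F is not Artinian and no nonzero
subquotient is killed by a two-sided ideal meeting the complement of F, modules of finite length are
cyclic (`exists_span_singleton_eq_top`). Lifting a generator of I/Ra gives the second generator of
I.

If I ⊆ F is finitely generated, a power of T kills all generators. They split into finitely many
elements killed by T, which distinct powers of S pack into one element (`exists_eq_span_singleton`).
-/

namespace IntegroDiff

/-! ### Commutation rules, the ideal of finite rank elements, two-sided ideals. -/

section Triple

variable {K R : Type*} [Field K] [Ring R] [Algebra K R]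

/-- The span of the elements `S ^ i * (1 - S * T) * T ^ j`. -/
def finiteRank (K : Type*) {R : Type*} [Field K] [Ring R] [Algebra K R] (S T : R) :
    Submodule K R :=
  Submodule.span K (Set.range fun p : ℕ × ℕ => S ^ p.1 * (1 - S * T) * T ^ p.2)

/-- Elements satisfying the defining relations of integration `S`, derivation `T` and the
Euler-type operator `H` (the derivation composed with multiplication by the variable),
generating the algebra, with `finiteRank K S T` a proper subspace. -/
structure IsIntegroDiffTriple (K : Type*) {R : Type*} [Field K] [Ring R] [Algebra K R]
    (S T H : R) : Prop where
  mul_eq_one : T * S = 1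
  mul_mul_eq : S * H * T = H - 1
  adjoin_eq_top : Algebra.adjoin K {S, T, H} = ⊤
  one_notMem : (1 : R) ∉ finiteRank K S T

namespace IsIntegroDiffTriple

variable {S T H : R} (h : IsIntegroDiffTriple K S T H)
include h

theorem T_mul_H : T * H = (H + 1) * T := by
  have h1 : T * (S * H * T) = H * T := by
    rw [← mul_assoc, ← mul_assoc, h.mul_eq_one, one_mul]
  rw [h.mul_mul_eq, mul_sub, mul_one, sub_eq_iff_eq_add] at h1
  rw [h1, add_mul, one_mul]

theorem H_mul_S : H * S = S * (H + 1) := by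
  have h1 : (S * H * T) * S = S * H := by
    rw [mul_assoc, h.mul_eq_one, mul_one]
  rw [h.mul_mul_eq, sub_mul, one_mul, sub_eq_iff_eq_add] at h1
  rw [h1, mul_add, mul_one]

theorem proj_mul_S : (1 - S * T) * S = 0 := by
  rw [sub_mul, one_mul, mul_assoc, h.mul_eq_one, mul_one, sub_self]

theorem T_mul_proj : T * (1 - S * T) = 0 := by
  rw [mul_sub, mul_one, ← mul_assoc, h.mul_eq_one, one_mul, sub_self]

theorem proj_mul_H : (1 - S * T) * H = 1 - S * T := by
  have h1 : S * T * H = S * H * T + S * T := by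
    rw [mul_assoc, h.T_mul_H]; noncomm_ring
  rw [sub_mul, one_mul, h1, h.mul_mul_eq]
  abel

theorem H_mul_proj : H * (1 - S * T) = 1 - S * T := by
  have h1 : H * (S * T) = S * H * T + S * T := by
    rw [← mul_assoc, h.H_mul_S]; noncomm_ring
  rw [mul_sub, mul_one, h1, h.mul_mul_eq]
  abel

theorem T_pow_mul_S_pow (n : ℕ) : T ^ n * S ^ n = 1 := by
  induction n with
  | zero => simp
  | succ n ih =>
    rw [pow_succ, pow_succ' S, mul_assoc, ← mul_assoc T, h.mul_eq_one, one_mul, ih]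

theorem T_mul_aeval (p : K[X]) : T * aeval H p = aeval H (taylor 1 p) * T := by
  induction p using Polynomial.induction_on' with
  | add p q hp hq => simp only [map_add, mul_add, add_mul, hp, hq]
  | monomial n c =>
    have key : T * H ^ n = (H + 1) ^ n * T := by
      induction n with
      | zero => simp
      | succ n ih => rw [pow_succ, ← mul_assoc, ih, mul_assoc, h.T_mul_H, pow_succ, mul_assoc]
    rw [taylor_monomial, aeval_monomial, map_mul, aeval_C, map_pow, map_add, aeval_X, aeval_C,
      map_one, ← mul_assoc, ← Algebra.commutes, mul_assoc, key, mul_assoc]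

theorem T_pow_mul_aeval (n : ℕ) (p : K[X]) :
    T ^ n * aeval H p = aeval H (taylor (n : K) p) * T ^ n := by
  induction n generalizing p with
  | zero => simp
  | succ n ih =>
    rw [pow_succ, mul_assoc, h.T_mul_aeval, ← mul_assoc, ih, taylor_taylor, mul_assoc,
      Nat.cast_succ]

theorem T_pow_mul_H (n : ℕ) : T ^ n * H = H * T ^ n + (n : K) • T ^ n := by
  have := h.T_pow_mul_aeval n X
  rw [aeval_X, taylor_X, map_add, aeval_X, aeval_C, add_mul, ← Algebra.smul_def] at this
  exact this

theorem proj_mul_aeval (p : K[X]) : (1 - S * T) * aeval H p = p.eval 1 • (1 - S * T) := by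
  induction p using Polynomial.induction_on' with
  | add p q hp hq => simp only [map_add, mul_add, eval_add, add_smul, hp, hq]
  | monomial n c =>
    have key : (1 - S * T) * H ^ n = 1 - S * T := by
      induction n with
      | zero => simp
      | succ n ih => rw [pow_succ, ← mul_assoc, ih, h.proj_mul_H]
    rw [aeval_monomial, ← mul_assoc, ← Algebra.commutes, mul_assoc, key, eval_monomial, one_pow,
      mul_one, Algebra.smul_def]

theorem adjoin_induction_left {p : R → Prop} (hS : p S) (hT : p T) (hH : p H)
    (halg : ∀ c : K, p (algebraMap K R c)) (hadd : ∀ x y, p x → p y → p (x + y))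
    (hmul : ∀ x y, p x → p y → p (x * y)) (r : R) : p r := by
  have hr : r ∈ Algebra.adjoin K {S, T, H} := h.adjoin_eq_top ▸ Algebra.mem_top
  induction hr using Algebra.adjoin_induction with
  | mem x hx =>
    rcases hx with rfl | rfl | rfl
    exacts [hS, hT, hH]
  | algebraMap c => exact halg c
  | add x y _ _ hx hy => exact hadd x y hx hy
  | mul x y _ _ hx hy => exact hmul x y hx hy

/-- A subspace stable under the three generators is a submodule. -/
theorem smul_mem_of_stable {M : Type*} [AddCommGroup M] [Module K M] [Module R M]
    [IsScalarTower K R M] (W : Submodule K M) (hS : ∀ x ∈ W, S • x ∈ W)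
    (hT : ∀ x ∈ W, T • x ∈ W) (hH : ∀ x ∈ W, H • x ∈ W) (r : R) : ∀ x ∈ W, r • x ∈ W := by
  refine h.adjoin_induction_left (p := fun r => ∀ x ∈ W, r • x ∈ W) hS hT hH ?_ ?_ ?_ r
  · intro c x hx
    rw [algebraMap_smul]
    exact W.smul_mem c hx
  · intro a b ha hb x hx
    rw [add_smul]
    exact W.add_mem (ha x hx) (hb x hx)
  · intro a b ha hb x hx
    rw [mul_smul]
    exact ha _ (hb x hx)

/-- The right ideal generated by `1 - S * T` is spanned by the `(1 - S * T) * T ^ j`. -/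
theorem proj_mul_mem (r : R) :
    (1 - S * T) * r ∈ Submodule.span K (Set.range fun j : ℕ => (1 - S * T) * T ^ j) := by
  set W := Submodule.span K (Set.range fun j : ℕ => (1 - S * T) * T ^ j) with hW
  have gen : ∀ j : ℕ, (1 - S * T) * T ^ j ∈ W := fun j => Submodule.subset_span ⟨j, rfl⟩
  have of_gen : ∀ a : R, (∀ j : ℕ, (1 - S * T) * T ^ j * a ∈ W) → ∀ x ∈ W, x * a ∈ W := by
    intro a ha x hx
    have : W ≤ W.comap (LinearMap.mulRight K a) := by
      conv_lhs => rw [hW]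
      rw [Submodule.span_le]
      rintro _ ⟨j, rfl⟩
      exact ha j
    exact this hx
  have key : ∀ x ∈ W, x * r ∈ W := by
    refine h.adjoin_induction_left (p := fun r => ∀ x ∈ W, x * r ∈ W) ?_ ?_ ?_ ?_ ?_ ?_ r
    · refine of_gen S fun j => ?_
      cases j with
      | zero => simp [h.proj_mul_S]
      | succ j =>
        rw [pow_succ, mul_assoc, mul_assoc (T ^ j), h.mul_eq_one, mul_one]
        exact gen j
    · refine of_gen T fun j => ?_
      rw [mul_assoc, ← pow_succ]
      exact gen _
    · refine of_gen H fun j => ?_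
      rw [mul_assoc, h.T_pow_mul_H, mul_add, ← mul_assoc, h.proj_mul_H, mul_smul_comm]
      exact W.add_mem (gen j) (W.smul_mem _ (gen j))
    · intro c x hx
      rw [← Algebra.commutes, ← Algebra.smul_def]
      exact W.smul_mem c hx
    · intro a b ha hb x hx
      rw [mul_add]
      exact W.add_mem (ha x hx) (hb x hx)
    · intro a b ha hb x hx
      rw [← mul_assoc]
      exact hb _ (ha x hx)
  refine key _ ?_
  simpa using gen 0

theorem S_pow_mul_proj_mul_mem (i : ℕ) (r : R) :
    S ^ i * ((1 - S * T) * r) ∈ finiteRank K S T := by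
  have : Submodule.span K (Set.range fun j : ℕ => (1 - S * T) * T ^ j) ≤
      (finiteRank K S T).comap (LinearMap.mulLeft K (S ^ i)) := by
    rw [Submodule.span_le]
    rintro _ ⟨j, rfl⟩
    refine Submodule.subset_span ⟨(i, j), ?_⟩
    simp [mul_assoc]
  exact this (h.proj_mul_mem r)

theorem mul_mem_finiteRank_right (r : R) {x : R} (hx : x ∈ finiteRank K S T) :
    x * r ∈ finiteRank K S T := by
  have : finiteRank K S T ≤ (finiteRank K S T).comap (LinearMap.mulRight K r) := by
    conv_lhs => rw [finiteRank]
    rw [Submodule.span_le]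
    rintro _ ⟨⟨i, j⟩, rfl⟩
    have := h.S_pow_mul_proj_mul_mem i (T ^ j * r)
    simpa [mul_assoc] using this
  exact this hx

/-- In the model, S ^ i * (1 - S * T) has image spanned by x ^ i, an eigenvector of ∂x. -/
theorem H_mul_S_pow_mul_proj (i : ℕ) :
    H * (S ^ i * (1 - S * T)) = ((i : K) + 1) • (S ^ i * (1 - S * T)) := by
  induction i with
  | zero => simp [h.H_mul_proj]
  | succ i ih =>
    rw [pow_succ', mul_assoc S, ← mul_assoc H, h.H_mul_S, mul_assoc S, add_mul, ih, one_mul,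
      mul_add, mul_smul_comm, Nat.cast_succ]
    module

theorem mul_mem_finiteRank_left (r : R) {x : R} (hx : x ∈ finiteRank K S T) :
    r * x ∈ finiteRank K S T := by
  have of_gen : ∀ a : R, (∀ i j : ℕ, a * (S ^ i * (1 - S * T) * T ^ j) ∈ finiteRank K S T) →
      ∀ x ∈ finiteRank K S T, a • x ∈ finiteRank K S T := by
    intro a ha x hx
    have : finiteRank K S T ≤ (finiteRank K S T).comap (LinearMap.mulLeft K a) := by
      conv_lhs => rw [finiteRank]
      rw [Submodule.span_le]
      rintro _ ⟨⟨i, j⟩, rfl⟩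
      exact ha i j
    exact this hx
  have gen : ∀ i j : ℕ, S ^ i * (1 - S * T) * T ^ j ∈ finiteRank K S T :=
    fun i j => Submodule.subset_span ⟨(i, j), rfl⟩
  refine h.smul_mem_of_stable (finiteRank K S T) (of_gen S ?_) (of_gen T ?_) (of_gen H ?_) r x hx
  · intro i j
    rw [← mul_assoc, ← mul_assoc, ← pow_succ']
    exact gen _ _
  · intro i j
    cases i with
    | zero =>
      rw [pow_zero, one_mul, ← mul_assoc, h.T_mul_proj, zero_mul]
      exact Submodule.zero_mem _
    | succ i =>
      rw [pow_succ', mul_assoc, mul_assoc, ← mul_assoc T, h.mul_eq_one, one_mul, ← mul_assoc]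
      exact gen _ _
  · intro i j
    rw [← mul_assoc, h.H_mul_S_pow_mul_proj, smul_mul_assoc]
    exact Submodule.smul_mem _ _ (gen _ _)

-- A telescoping sum. It recovers x from T ^ n * x and the components (1 - S * T) * T ^ i * x with i
-- < n, like a Taylor expansion with remainder.
omit h in
theorem eq_sum_add (S T : R) (n : ℕ) :
    (1 : R) = (∑ i ∈ Finset.range n, S ^ i * (1 - S * T) * T ^ i) + S ^ n * T ^ n := by
  induction n with
  | zero => simp
  | succ n ih =>
    rw [Finset.sum_range_succ, add_assoc]
    conv_lhs => rw [ih]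
    congr 1
    rw [pow_succ, pow_succ' T]
    noncomm_ring

theorem mem_finiteRank_of_T_pow_mul_eq_zero {n : ℕ} {x : R} (hx : T ^ n * x = 0) :
    x ∈ finiteRank K S T := by
  rw [← one_mul x, eq_sum_add S T n, add_mul, mul_assoc, hx, mul_zero, add_zero,
    Finset.sum_mul]
  refine Submodule.sum_mem _ fun i _ => ?_
  rw [mul_assoc, mul_assoc]
  exact h.S_pow_mul_proj_mul_mem i _

theorem exists_T_pow_mul_eq_zero {x : R} (hx : x ∈ finiteRank K S T) :
    ∃ n, T ^ n * x = 0 := by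
  induction hx using Submodule.span_induction with
  | mem x hx =>
    obtain ⟨⟨i, j⟩, rfl⟩ := hx
    refine ⟨i + 1, ?_⟩
    simp only
    rw [pow_succ', ← mul_assoc, ← mul_assoc, mul_assoc T, h.T_pow_mul_S_pow, mul_one,
      h.T_mul_proj, zero_mul]
  | zero => exact ⟨0, by simp⟩
  | add x y _ _ hx hy =>
    obtain ⟨n, hn⟩ := hx
    obtain ⟨m, hm⟩ := hy
    refine ⟨n + m, ?_⟩
    have h1 : T ^ (n + m) * x = 0 := by rw [add_comm, pow_add, mul_assoc, hn, mul_zero]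
    have h2 : T ^ (n + m) * y = 0 := by rw [pow_add, mul_assoc, hm, mul_zero]
    rw [mul_add, h1, h2, add_zero]
  | smul c x _ hx =>
    obtain ⟨n, hn⟩ := hx
    exact ⟨n, by rw [mul_smul_comm, hn, smul_zero]⟩

/-- The finite rank elements as a left ideal. -/
def finiteRankIdeal : Ideal R where
  carrier := finiteRank K S T
  add_mem' := Submodule.add_mem _
  zero_mem' := Submodule.zero_mem _
  smul_mem' r _ hx := h.mul_mem_finiteRank_left r hx

theorem mem_finiteRankIdeal {x : R} : x ∈ h.finiteRankIdeal ↔ x ∈ finiteRank K S T :=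
  Iff.rfl

theorem isTwoSided_finiteRankIdeal : h.finiteRankIdeal.IsTwoSided :=
  ⟨fun {_} r hx => h.mul_mem_finiteRank_right r hx⟩

/-- T * p(H) * S = p(H + 1), so J contains the difference p(H + 1) - p(H). It has smaller degree,
and in characteristic zero it vanishes only for constant p. -/
theorem one_mem_of_aeval_mem [CharZero K] (J : Ideal R) [J.IsTwoSided] {p : K[X]} (hp : p ≠ 0)
    (hJ : aeval H p ∈ J) : (1 : R) ∈ J := by
  induction hn : p.natDegree using Nat.strong_induction_on generalizing p with
  | _ n ih =>
    by_cases h0 : p.natDegree = 0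
    · obtain ⟨c, rfl⟩ := natDegree_eq_zero.mp h0
      have hc : c ≠ 0 := by rintro rfl; simp at hp
      have := J.mul_mem_left (algebraMap K R c⁻¹) hJ
      rwa [aeval_C, ← map_mul, inv_mul_cancel₀ hc, map_one] at this
    · have h1 : aeval H (taylor 1 p) ∈ J := by
        have := J.mul_mem_right S (J.mul_mem_left T hJ)
        rwa [h.T_mul_aeval, mul_assoc, h.mul_eq_one, mul_one] at this
      have hne : taylor 1 p - p ≠ 0 := by
        intro heq
        rw [sub_eq_zero] at heq
        have hev : ∀ m : ℕ, p.eval (m : K) = p.eval 0 := by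
          intro m
          induction m with
          | zero => simp
          | succ m ihm =>
            rw [← ihm]
            conv_rhs => rw [← heq]
            rw [taylor_eval]
            simp
        have : p = C (p.eval 0) := by
          refine eq_of_infinite_eval_eq _ _ ?_
          refine (Set.infinite_range_of_injective (Nat.cast_injective (R := K))).mono ?_
          rintro _ ⟨m, rfl⟩
          simp [hev m]
        exact h0 (this ▸ natDegree_C _)
      have hlt : (taylor 1 p - p).natDegree < p.natDegree := by
        refine natDegree_lt_natDegree hne ?_
        rw [← degree_taylor p 1]
        refine degree_sub_lt_left (degree_taylor p 1) ?_ (leadingCoeff_taylor ..)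
        simpa using hp
      refine ih _ (hn ▸ hlt) hne ?_ rfl
      rw [map_sub]
      exact J.sub_mem h1 hJ

/-- The commutator with H multiplies the j-th term by -j. Adding i times the sum removes the i-th
term and scales the others by i - j ≠ 0, until a single term is left. -/
theorem one_mem_of_sum_mem [CharZero K] (J : Ideal R) [J.IsTwoSided] {s : Finset ℕ}
    (hs : s.Nonempty) (f : ℕ → K[X]) (hf : ∀ i ∈ s, f i ≠ 0)
    (hJ : ∑ i ∈ s, aeval H (f i) * T ^ i ∈ J) : (1 : R) ∈ J := by
  induction s using Finset.induction_on generalizing f with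
  | empty => simp at hs
  | insert i s hi ih =>
    rcases s.eq_empty_or_nonempty with rfl | hs'
    · rw [insert_empty_eq, Finset.sum_singleton] at hJ
      have := J.mul_mem_right (S ^ i) hJ
      rw [mul_assoc, h.T_pow_mul_S_pow, mul_one] at this
      exact h.one_mem_of_aeval_mem J (hf i (by simp)) this
    · refine ih hs' (fun j => C ((i : K) - j) * f j) ?_ ?_
      · intro j hj
        refine mul_ne_zero ?_ (hf j (Finset.mem_insert_of_mem hj))
        rw [Ne, C_eq_zero, sub_eq_zero, Nat.cast_inj]
        rintro rfl
        exact hi hj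
      · have hx := J.add_mem (J.sub_mem (J.mul_mem_left H hJ) (J.mul_mem_right H hJ))
          (J.mul_mem_left (algebraMap K R i) hJ)
        have term : ∀ j, H * (aeval H (f j) * T ^ j) - aeval H (f j) * T ^ j * H +
            algebraMap K R i * (aeval H (f j) * T ^ j) =
            aeval H (C ((i : K) - j) * f j) * T ^ j := by
          intro j
          have hc : H * aeval H (f j) = aeval H (f j) * H := by
            have := congrArg (aeval H) (mul_comm X (f j))
            simpa using this
          rw [mul_assoc (aeval H (f j)) (T ^ j) H, h.T_pow_mul_H, ← mul_assoc H, hc, map_mul,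
            aeval_C, map_sub, mul_add, mul_smul_comm, Algebra.smul_def, sub_mul, sub_mul]
          simp only [mul_assoc]
          abel
        rw [Finset.mul_sum, Finset.sum_mul, Finset.mul_sum, ← Finset.sum_sub_distrib,
          ← Finset.sum_add_distrib, Finset.sum_congr rfl fun j _ => term j,
          Finset.sum_insert hi, sub_self, C_0, zero_mul, map_zero, zero_mul, zero_add] at hx
        exact hx

theorem eq_zero_of_sum_mem_finiteRank [CharZero K] {s : Finset ℕ} {f : ℕ → K[X]}
    (hJ : ∑ i ∈ s, aeval H (f i) * T ^ i ∈ finiteRank K S T) : ∀ i ∈ s, f i = 0 := by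
  classical
  by_contra! hne
  obtain ⟨i, hi, hfi⟩ := hne
  have := h.isTwoSided_finiteRankIdeal
  refine h.one_notMem (h.one_mem_of_sum_mem h.finiteRankIdeal (s := s.filter fun i => f i ≠ 0)
    ⟨i, by simp [hi, hfi]⟩ f (by simp) ?_)
  rw [Finset.sum_filter_of_ne]
  · exact hJ
  · rintro j _ hj h0
    simp [h0] at hj

end IsIntegroDiffTriple

end Triple

end IntegroDiff

namespace IntegroDiff

/-! ### Filtration of a cyclic module; absence of finite-dimensional modules. -/

section Growth

variable {K R M : Type*} [Field K] [Ring R] [Algebra K R] [AddCommGroup M] [Module K M]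
  [Module R M] [IsScalarTower K R M]

/-- The span of the vectors `(p(H) * T ^ j) • v` with `p` of degree at most `N` and `j ≤ N`. -/
def bounded (K : Type*) {R M : Type*} [Field K] [Ring R] [Algebra K R] [AddCommGroup M]
    [Module K M] [Module R M] (T H : R) (v : M) (N : ℕ) : Submodule K M :=
  Submodule.span K {x | ∃ (p : K[X]) (j : ℕ), p.natDegree ≤ N ∧ j ≤ N ∧
    x = (aeval H p * T ^ j) • v}

/-- The vectors which `T ^ n` maps into `bounded K T H v (2 * n)`. -/
def level (K : Type*) {R M : Type*} [Field K] [Ring R] [Algebra K R] [AddCommGroup M]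
    [Module K M] [Module R M] [IsScalarTower K R M] (T H : R) (v : M) (n : ℕ) :
    Submodule K M :=
  (bounded K T H v (2 * n)).comap (Algebra.lsmul K K M (T ^ n))

omit [IsScalarTower K R M] in
theorem mem_bounded {T H : R} {v : M} {N : ℕ} {p : K[X]} {j : ℕ} (hp : p.natDegree ≤ N)
    (hj : j ≤ N) : (aeval H p * T ^ j) • v ∈ bounded K T H v N :=
  Submodule.subset_span ⟨p, j, hp, hj, rfl⟩

omit [IsScalarTower K R M] in
theorem bounded_mono {T H : R} {v : M} {N N' : ℕ} (hN : N ≤ N') :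
    bounded K T H v N ≤ bounded K T H v N' := by
  refine Submodule.span_le.mpr ?_
  rintro _ ⟨p, j, hp, hj, rfl⟩
  exact mem_bounded (hp.trans hN) (hj.trans hN)

theorem mem_level {T H : R} {v : M} {n : ℕ} {x : M} :
    x ∈ level K T H v n ↔ T ^ n • x ∈ bounded K T H v (2 * n) :=
  Iff.rfl

theorem exists_sum_of_mem_bounded {T H : R} {v : M} {N : ℕ} {x : M}
    (hx : x ∈ bounded K T H v N) : ∃ f : ℕ → K[X],
      x = (∑ j ∈ Finset.range (N + 1), aeval H (f j) * T ^ j) • v := by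
  induction hx using Submodule.span_induction with
  | mem x hx =>
    obtain ⟨p, j, hp, hj, rfl⟩ := hx
    refine ⟨fun i => if i = j then p else 0, ?_⟩
    rw [Finset.sum_eq_single j]
    · simp
    · intro i _ hij
      simp [hij]
    · intro hn
      simp at hn
      omega
  | zero => exact ⟨fun _ => 0, by simp⟩
  | add x y _ _ hx hy =>
    obtain ⟨f, rfl⟩ := hx
    obtain ⟨g, rfl⟩ := hy
    refine ⟨fun i => f i + g i, ?_⟩
    simp only [map_add, add_mul, Finset.sum_add_distrib, add_smul]
  | smul c x _ hx =>
    obtain ⟨f, rfl⟩ := hx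
    refine ⟨fun i => c • f i, ?_⟩
    simp only [map_smul, smul_mul_assoc, ← Finset.smul_sum, smul_assoc]

namespace IsIntegroDiffTriple

variable {S T H : R} (h : IsIntegroDiffTriple K S T H)
include h

theorem T_smul_mem_bounded {v x : M} {N : ℕ} (hx : x ∈ bounded K T H v N) :
    T • x ∈ bounded K T H v (N + 1) := by
  have : bounded K T H v N ≤ (bounded K T H v (N + 1)).comap (Algebra.lsmul K K M T) := by
    refine Submodule.span_le.mpr ?_
    rintro _ ⟨p, j, hp, hj, rfl⟩
    change T • (aeval H p * T ^ j) • v ∈ bounded K T H v (N + 1)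
    rw [← mul_smul, ← mul_assoc, h.T_mul_aeval, mul_assoc, ← pow_succ']
    exact mem_bounded (by rw [natDegree_taylor]; omega) (by omega)
  exact this hx

omit h in
theorem H_smul_mem_bounded {v x : M} {N : ℕ} (hx : x ∈ bounded K T H v N) :
    H • x ∈ bounded K T H v (N + 1) := by
  have : bounded K T H v N ≤ (bounded K T H v (N + 1)).comap (Algebra.lsmul K K M H) := by
    refine Submodule.span_le.mpr ?_
    rintro _ ⟨p, j, hp, hj, rfl⟩
    change H • (aeval H p * T ^ j) • v ∈ bounded K T H v (N + 1)
    have : H * aeval H p = aeval H (X * p) := by simp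
    rw [← mul_smul, ← mul_assoc, this]
    refine mem_bounded (natDegree_mul_le.trans ?_) (by omega)
    rw [natDegree_X]
    omega
  exact this hx

/-- T ^ (n + 1) * T = T * T * T ^ n costs two steps in `bounded`, which is why `level` uses the
bound 2 * n. -/
theorem T_smul_mem_level {v x : M} {n : ℕ} (hx : x ∈ level K T H v n) :
    T • x ∈ level K T H v (n + 1) := by
  rw [mem_level] at hx ⊢
  rw [← mul_smul, ← pow_succ, pow_succ', pow_succ', mul_smul, mul_smul]
  exact h.T_smul_mem_bounded (h.T_smul_mem_bounded hx)

theorem S_smul_mem_level {v x : M} {n : ℕ} (hx : x ∈ level K T H v n) :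
    S • x ∈ level K T H v (n + 1) := by
  rw [mem_level] at hx ⊢
  rw [← mul_smul, pow_succ, mul_assoc, h.mul_eq_one, mul_one]
  exact bounded_mono (by omega) hx

theorem level_le_succ (v : M) (n : ℕ) : level K T H v n ≤ level K T H v (n + 1) := by
  intro x hx
  rw [mem_level] at hx ⊢
  rw [pow_succ', mul_smul]
  exact bounded_mono (by omega) (h.T_smul_mem_bounded hx)

theorem level_mono (v : M) : Monotone (level K T H v) :=
  monotone_nat_of_le_succ (h.level_le_succ v)

theorem H_smul_mem_level {v x : M} {n : ℕ} (hx : x ∈ level K T H v n) :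
    H • x ∈ level K T H v (n + 1) := by
  have hx' := h.level_le_succ v n hx
  rw [mem_level] at hx hx' ⊢
  rw [← mul_smul, h.T_pow_mul_H, add_smul, mul_smul, smul_assoc]
  refine Submodule.add_mem _ ?_ (Submodule.smul_mem _ _ hx')
  rw [pow_succ', mul_smul]
  exact H_smul_mem_bounded (h.T_smul_mem_bounded hx)

theorem exists_mem_level (v : M) (r : R) : ∃ n, r • v ∈ level K T H v n := by
  have key : ∀ n, ∀ x ∈ level K T H v n, ∃ m, r • x ∈ level K T H v m := by
    refine h.adjoin_induction_left
      (p := fun r => ∀ n, ∀ x ∈ level K T H v n, ∃ m, r • x ∈ level K T H v m)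
      (fun n x hx => ⟨_, h.S_smul_mem_level hx⟩) (fun n x hx => ⟨_, h.T_smul_mem_level hx⟩)
      (fun n x hx => ⟨_, h.H_smul_mem_level hx⟩) ?_ ?_ ?_ r
    · intro c n x hx
      exact ⟨n, by rw [algebraMap_smul]; exact Submodule.smul_mem _ c hx⟩
    · intro a b ha hb n x hx
      obtain ⟨k, hk⟩ := ha n x hx
      obtain ⟨l, hl⟩ := hb n x hx
      refine ⟨max k l, ?_⟩
      rw [add_smul]
      exact Submodule.add_mem _ (h.level_mono v (le_max_left k l) hk)
        (h.level_mono v (le_max_right k l) hl)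
    · intro a b ha hb n x hx
      obtain ⟨k, hk⟩ := hb n x hx
      obtain ⟨l, hl⟩ := ha k _ hk
      exact ⟨l, by rwa [mul_smul]⟩
  refine key 0 v ?_
  rw [mem_level, pow_zero, one_smul]
  have := mem_bounded (K := K) (T := T) (H := H) (v := v) (N := 0) (p := 1) (j := 0)
    (by simp) le_rfl
  simpa using this

/-- Up to a power of `T` every element is a polynomial in `T` over `K[H]`. -/
theorem exists_T_pow_mul_eq_sum (r : R) : ∃ (n : ℕ) (f : ℕ → K[X]),
    T ^ n * r = ∑ j ∈ Finset.range (2 * n + 1), aeval H (f j) * T ^ j := by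
  obtain ⟨n, hn⟩ := h.exists_mem_level (1 : R) r
  rw [smul_eq_mul, mul_one, mem_level] at hn
  obtain ⟨f, hf⟩ := exists_sum_of_mem_bounded hn
  exact ⟨n, f, by simpa using hf⟩

/-- An element outside `finiteRank K S T` has a left multiple which is a nonzero polynomial in
`T` over `K[H]`. -/
theorem exists_relation {a : R} (ha : a ∉ finiteRank K S T) :
    ∃ (n d : ℕ) (f : ℕ → K[X]), f d ≠ 0 ∧
      T ^ n * a = ∑ j ∈ Finset.range (d + 1), aeval H (f j) * T ^ j := by
  classical
  obtain ⟨n, f, hf⟩ := h.exists_T_pow_mul_eq_sum a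
  have hex : ∃ j ∈ Finset.range (2 * n + 1), f j ≠ 0 := by
    by_contra! hall
    refine ha (h.mem_finiteRank_of_T_pow_mul_eq_zero (n := n) ?_)
    rw [hf]
    exact Finset.sum_eq_zero fun j hj => by simp [hall j hj]
  let s := (Finset.range (2 * n + 1)).filter fun j => f j ≠ 0
  have hs : s.Nonempty := by
    obtain ⟨j, hj, hfj⟩ := hex
    exact ⟨j, Finset.mem_filter.mpr ⟨hj, hfj⟩⟩
  have hmax := Finset.mem_filter.mp (s.max'_mem hs)
  refine ⟨n, s.max' hs, f, hmax.2, ?_⟩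
  rw [hf]
  symm
  refine Finset.sum_subset ?_ ?_
  · intro j hj
    have := Finset.mem_range.mp hmax.1
    rw [Finset.mem_range] at hj ⊢
    omega
  · intro j hj hj'
    have : f j = 0 := by
      by_contra hne
      have := s.le_max' j (Finset.mem_filter.mpr ⟨hj, hne⟩)
      rw [Finset.mem_range] at hj'
      omega
    simp [this]

/-- There is no nonzero finite-dimensional module. -/
theorem eq_bot_of_stable [CharZero K] (W : Submodule K M) [FiniteDimensional K W]
    (hS : ∀ x ∈ W, S • x ∈ W) (hT : ∀ x ∈ W, T • x ∈ W) (hH : ∀ x ∈ W, H • x ∈ W) :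
    W = ⊥ := by
  let s : Module.End K W := (Algebra.lsmul K K M S).restrict hS
  let t : Module.End K W := (Algebra.lsmul K K M T).restrict hT
  let u : Module.End K W := (Algebra.lsmul K K M H).restrict hH
  have hts : t * s = 1 := by
    ext x
    change T • S • (x : M) = x
    rw [← mul_smul, h.mul_eq_one, one_smul]
  have hst : s * t = 1 := mul_eq_one_comm.mp hts
  have htu : t * u = (u + 1) * t := by
    ext x
    change T • H • (x : M) = H • T • (x : M) + T • (x : M)
    rw [← mul_smul, h.T_mul_H, add_mul, one_mul, add_smul, mul_smul]
  -- Since t * u * s is also u + 1, comparing traces gives dim W = 0 in K, hence dim W = 0 in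
  -- characteristic zero.
  have htr : LinearMap.trace K W (t * u * s) = LinearMap.trace K W u := by
    rw [LinearMap.trace_mul_comm, ← mul_assoc, hst, one_mul]
  rw [htu, mul_assoc, hts, mul_one, map_add, LinearMap.trace_one, add_eq_left,
    Nat.cast_eq_zero, Submodule.finrank_eq_zero] at htr
  exact htr

end IsIntegroDiffTriple

end Growth

end IntegroDiff

namespace IntegroDiff

/-! ### Linear upper bound for the growth under a relation. -/

section Growth

variable {K R M : Type*} [Field K] [Ring R] [Algebra K R] [AddCommGroup M] [Module K M]
  [Module R M] [IsScalarTower K R M]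

/-- The vectors `(H ^ k * T ^ j) • v` with `k ≤ N` and `j < d`, or `k < e` and `j ≤ N`. -/
def hook {R M : Type*} [Ring R] [AddCommGroup M] [Module R M] (T H : R) (v : M) (d e N : ℕ) :
    Set M :=
  (fun q : ℕ × ℕ => (H ^ q.1 * T ^ q.2) • v) ''
    ((Finset.range (N + 1) ×ˢ Finset.range d ∪ Finset.range e ×ˢ Finset.range (N + 1) :
      Finset (ℕ × ℕ)) : Set (ℕ × ℕ))

theorem finite_hook (T H : R) (v : M) (d e N : ℕ) : (hook T H v d e N).Finite :=
  (Finset.finite_toSet _).image _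

omit [Algebra K R] [IsScalarTower K R M] in
theorem finrank_span_hook_le (T H : R) (v : M) (d e N : ℕ) :
    Module.finrank K (Submodule.span K (hook T H v d e N)) ≤ (d + e) * (N + 1) := by
  classical
  rw [hook, ← Finset.coe_image]
  refine (finrank_span_finset_le_card _).trans (Finset.card_image_le.trans ?_)
  refine (Finset.card_union_le _ _).trans (le_of_eq ?_)
  simp only [Finset.card_product, Finset.card_range]
  ring

theorem aeval_smul_mem_span_hook {T H : R} {v : M} {d e N j : ℕ} {p : K[X]}
    (hp : ∀ k, p.coeff k ≠ 0 → k ≤ N ∧ j < d ∨ k < e ∧ j ≤ N) :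
    (aeval H p * T ^ j) • v ∈ Submodule.span K (hook T H v d e N) := by
  rw [aeval_eq_sum_range, Finset.sum_mul, Finset.sum_smul]
  refine Submodule.sum_mem _ fun k _ => ?_
  rw [smul_mul_assoc, smul_assoc]
  by_cases hk : p.coeff k = 0
  · simp [hk]
  · refine Submodule.smul_mem _ _ (Submodule.subset_span ⟨(k, j), ?_, rfl⟩)
    have := hp k hk
    simp only [Finset.coe_union, Finset.coe_product, Finset.coe_range, Set.mem_union,
      Set.mem_prod, Set.mem_Iio]
    omega

omit [Algebra K R] [IsScalarTower K R M] in
theorem span_hook_mono {T H : R} {v : M} {d e N N' : ℕ} (hN : N ≤ N') :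
    Submodule.span K (hook T H v d e N) ≤ Submodule.span K (hook T H v d e N') := by
  refine Submodule.span_mono (Set.image_mono ?_)
  intro q
  simp only [Finset.coe_union, Finset.coe_product, Finset.coe_range, Set.mem_union,
    Set.mem_prod, Set.mem_Iio]
  omega

namespace IsIntegroDiffTriple

variable {S T H : R} (h : IsIntegroDiffTriple K S T H)
include h

/-- Division by a relation with leading coefficient `f d` in `K[H]`. -/
theorem aeval_mul_T_pow_smul_mem {v : M} {d c : ℕ} {f : ℕ → K[X]} (hd : f d ≠ 0)
    (hrel : (∑ j ∈ Finset.range (d + 1), aeval H (f j) * T ^ j) • v = 0) (hc : 1 ≤ c)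
    (hf : ∀ j ≤ d, (f j).natDegree ≤ c) (j k : ℕ) (q : K[X]) (hq : q.natDegree ≤ k) :
    (aeval H q * T ^ j) • v ∈
      Submodule.span K (hook T H v d (f d).natDegree (k + c * j)) := by
  induction j using Nat.strong_induction_on generalizing k q with
  | _ j ih =>
    rcases lt_or_ge j d with hj | hj
    · refine aeval_smul_mem_span_hook fun i hi => Or.inl ⟨?_, hj⟩
      have := le_natDegree_of_ne_zero hi
      omega
    · obtain ⟨l, rfl⟩ := Nat.exists_eq_add_of_le' hj
      -- Moving T ^ l past the coefficients of the relation shifts their argument by l and keeps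
      -- their degrees.
      let g : ℕ → K[X] := fun i => taylor (l : K) (f i)
      have hgd : g d ≠ 0 := by simpa [g] using hd
      have hg : ∀ i, (g i).natDegree = (f i).natDegree := fun i => natDegree_taylor _ _
      have hrel' : ∀ a : R,
          ∑ i ∈ Finset.range (d + 1), (a * (aeval H (g i) * T ^ (i + l))) • v = 0 := by
        intro a
        have := congrArg (fun x => (a * T ^ l) • x) hrel
        simp only [smul_zero] at this
        rw [← mul_smul, Finset.mul_sum, Finset.sum_smul] at this
        rw [← this]
        refine Finset.sum_congr rfl fun i _ => ?_
        rw [mul_assoc a, ← mul_assoc (T ^ l), h.T_pow_mul_aeval, mul_assoc (aeval H _),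
          ← pow_add, add_comm l i]
      have hrel2 := hrel' (aeval H (q / g d))
      rw [Finset.sum_range_succ] at hrel2
      -- The relation trades the quotient part for lower powers of T, raising the degree by at most
      -- c. The remainder has degree below that of f d and lies in the other strip of the hook.
      have hq2 : aeval H q = aeval H (q / g d) * aeval H (g d) + aeval H (q % g d) := by
        rw [← map_mul, ← map_add, mul_comm, EuclideanDomain.div_add_mod]
      rw [add_comm l d, hq2, add_mul, add_smul, mul_assoc,
        eq_neg_of_add_eq_zero_right hrel2] at *
      refine Submodule.add_mem _ (Submodule.neg_mem _ (Submodule.sum_mem _ fun i hi => ?_)) ?_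
      · rw [← mul_assoc, ← map_mul]
        rw [Finset.mem_range] at hi
        refine span_hook_mono ?_ (ih (i + l) (by omega) (k + c) _ ?_)
        · have : c * (i + l + 1) ≤ c * (d + l) := Nat.mul_le_mul_left c (by omega)
          rw [mul_add c (i + l) 1] at this
          omega
        · refine natDegree_mul_le.trans ?_
          have h1 : (q / g d).natDegree ≤ q.natDegree := natDegree_le_natDegree (degree_div_le q _)
          have h2 := hf i hi.le
          rw [hg]
          omega
      · refine aeval_smul_mem_span_hook fun i hi => Or.inr ⟨?_, ?_⟩
        · rw [← hg]
          by_contra! hlt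
          refine hi (coeff_eq_zero_of_degree_lt ?_)
          have hdeg : (q % g d).degree < (g d).degree := EuclideanDomain.mod_lt q hgd
          refine hdeg.trans_le ((degree_le_natDegree).trans ?_)
          exact_mod_cast hlt
        · have : d + l ≤ c * (d + l) := Nat.le_mul_of_pos_left _ hc
          omega

theorem exists_bounded_le {v : M} {d : ℕ} {f : ℕ → K[X]} (hd : f d ≠ 0)
    (hrel : (∑ j ∈ Finset.range (d + 1), aeval H (f j) * T ^ j) • v = 0) :
    ∃ c e, ∀ N, bounded K T H v N ≤ Submodule.span K (hook T H v d e (c * N)) := by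
  obtain ⟨c, hc⟩ : ∃ c, ∀ j ≤ d, (f j).natDegree ≤ c := by
    refine ⟨(Finset.range (d + 1)).sup fun j => (f j).natDegree, fun j hj => ?_⟩
    exact Finset.le_sup (f := fun j => (f j).natDegree) (by simp; omega)
  refine ⟨c + 2, (f d).natDegree, fun N => Submodule.span_le.mpr ?_⟩
  rintro _ ⟨p, j, hp, hj, rfl⟩
  refine span_hook_mono ?_ (h.aeval_mul_T_pow_smul_mem hd hrel (c := c + 1) (by omega)
    (fun i hi => (hc i hi).trans (by omega)) j N p hp)
  nlinarith [Nat.mul_le_mul_left (c + 1) hj]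

/-- Under a relation the image of `1 - S * T` is finite-dimensional. -/
theorem exists_proj_smul_mem [CharZero K] {v : M} {d : ℕ} {f : ℕ → K[X]} (hd : f d ≠ 0)
    (hrel : (∑ j ∈ Finset.range (d + 1), aeval H (f j) * T ^ j) • v = 0) :
    ∃ E : Submodule K M, FiniteDimensional K E ∧ ∀ r : R, ((1 - S * T) * r) • v ∈ E := by
  -- Multiplying the relation by (1 - S * T) * T ^ l turns each coefficient into the scalar f i (l +
  -- 1). Once the leading scalar is nonzero, (1 - S * T) * T ^ (l + d) • v reduces to lower powers.
  obtain ⟨l₀, hl₀⟩ : ∃ l₀ : ℕ, ∀ l ≥ l₀, (f d).eval ((l : K) + 1) ≠ 0 := by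
    have hfin : {l : ℕ | (f d).eval ((l : K) + 1) = 0}.Finite := by
      have hr : {x : K | (f d).IsRoot x}.Finite := finite_setOfPred_isRoot hd
      refine hr.preimage (f := fun l : ℕ => (l : K) + 1) ?_
      intro a _ b _ hab
      simpa using hab
    obtain ⟨b, hb⟩ := hfin.bddAbove
    refine ⟨b + 1, fun l hl h0 => ?_⟩
    have := hb h0
    omega
  refine ⟨Submodule.span K ((fun j : ℕ => ((1 - S * T) * T ^ j) • v) ''
    (Finset.range (l₀ + d) : Set ℕ)),
    FiniteDimensional.span_of_finite K ((Finset.finite_toSet _).image _), fun r => ?_⟩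
  set E := Submodule.span K ((fun j : ℕ => ((1 - S * T) * T ^ j) • v) ''
    (Finset.range (l₀ + d) : Set ℕ)) with hE
  have key : ∀ j, ((1 - S * T) * T ^ j) • v ∈ E := by
    intro j
    induction j using Nat.strong_induction_on with
    | _ j ih =>
      rcases lt_or_ge j (l₀ + d) with hj | hj
      · exact Submodule.subset_span ⟨j, by simpa using hj, rfl⟩
      · obtain ⟨l, rfl⟩ := Nat.exists_eq_add_of_le' (le_trans (Nat.le_add_left d l₀) hj)
        have hrel2 := congrArg (fun x => ((1 - S * T) * T ^ l) • x) hrel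
        simp only [smul_zero] at hrel2
        have term : ∀ i, (1 - S * T) * T ^ l * (aeval H (f i) * T ^ i) =
            (f i).eval ((l : K) + 1) • ((1 - S * T) * T ^ (i + l)) := by
          intro i
          rw [mul_assoc, ← mul_assoc (T ^ l), h.T_pow_mul_aeval, mul_assoc (aeval H _),
            ← pow_add, ← mul_assoc, h.proj_mul_aeval, taylor_eval, smul_mul_assoc,
            add_comm l i, add_comm (1 : K)]
        rw [← mul_smul, Finset.mul_sum, Finset.sum_smul, Finset.sum_range_succ,
          Finset.sum_congr rfl fun i _ => by rw [term i, smul_assoc], term d, smul_assoc,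
          add_comm d l] at hrel2
        have hmem : (f d).eval ((l : K) + 1) • ((1 - S * T) * T ^ (l + d)) • v ∈ E := by
          rw [eq_neg_of_add_eq_zero_right hrel2]
          refine Submodule.neg_mem _ (Submodule.sum_mem _ fun i hi => Submodule.smul_mem _ _ ?_)
          rw [Finset.mem_range] at hi
          exact ih _ (by omega)
        exact (Submodule.smul_mem_iff _ (hl₀ l (by omega))).mp hmem
  have : Submodule.span K (Set.range fun j : ℕ => (1 - S * T) * T ^ j) ≤
      E.comap (LinearMap.toSpanSingleton R M v |>.restrictScalars K) := by
    refine Submodule.span_le.mpr ?_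
    rintro _ ⟨j, rfl⟩
    exact key j
  exact this (h.proj_mul_mem r)

/-- The levels of a cyclic module defined by a relation have linear growth. -/
theorem exists_finrank_level_le [CharZero K] {v : M} (hv : ∀ x : M, ∃ r : R, r • v = x)
    {a : R} (ha : a ∉ finiteRank K S T) (hav : a • v = 0) :
    ∃ C D : ℕ, ∀ n, FiniteDimensional K (level K T H v n) ∧
      Module.finrank K (level K T H v n) ≤ C * n + D := by
  obtain ⟨m, d, f, hd, hf⟩ := h.exists_relation ha
  have hrel : (∑ j ∈ Finset.range (d + 1), aeval H (f j) * T ^ j) • v = 0 := by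
    rw [← hf, mul_smul, hav, smul_zero]
  obtain ⟨c, e, hb⟩ := h.exists_bounded_le hd hrel
  obtain ⟨E, hEfin, hE⟩ := h.exists_proj_smul_mem hd hrel
  have hE' : ∀ x : M, (1 - S * T) • x ∈ E := by
    intro x
    obtain ⟨r, rfl⟩ := hv x
    rw [← mul_smul]
    exact hE r
  refine ⟨(d + e) * (c * 2) + Module.finrank K E, d + e, fun n => ?_⟩
  set V := Submodule.span K (hook T H v d e (c * (2 * n)))
  have : FiniteDimensional K V := FiniteDimensional.span_of_finite K (finite_hook ..)
  let φ₁ : level K T H v n →ₗ[K] V :=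
    ((Algebra.lsmul K K M (T ^ n)).comp (level K T H v n).subtype).codRestrict V
      fun x => hb _ x.2
  let φ₂ : level K T H v n →ₗ[K] (Fin n → E) :=
    LinearMap.pi fun i => ((Algebra.lsmul K K M ((1 - S * T) * T ^ (i : ℕ))).comp
      (level K T H v n).subtype).codRestrict E fun x => by
        change ((1 - S * T) * T ^ (i : ℕ)) • (x : M) ∈ E
        rw [mul_smul]
        exact hE' _
  -- By `eq_sum_add`, x is determined by T ^ n • x and its n components in E. Both targets have
  -- dimension at most linear in n.
  have hinj : Function.Injective (φ₁.prod φ₂) := by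
    rw [← LinearMap.ker_eq_bot, LinearMap.ker_eq_bot']
    rintro ⟨x, hx⟩ h0
    have h1 : T ^ n • x = 0 := congrArg (fun y => (y.1 : M)) h0
    have h2 : ∀ i : Fin n, ((1 - S * T) * T ^ (i : ℕ)) • x = 0 := fun i =>
      congrArg (fun y => (y.2 i : M)) h0
    have : x = 0 := by
      rw [← one_smul R x, eq_sum_add S T n, add_smul, mul_smul, h1, smul_zero, add_zero,
        Finset.sum_smul]
      refine Finset.sum_eq_zero fun i hi => ?_
      rw [mul_assoc, mul_smul, h2 ⟨i, Finset.mem_range.mp hi⟩, smul_zero]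
    simpa using this
  refine ⟨Module.Finite.of_injective _ hinj, ?_⟩
  refine (LinearMap.finrank_le_finrank_of_injective hinj).trans ?_
  rw [Module.finrank_prod, Module.finrank_pi_fintype, Finset.sum_const, Finset.card_univ,
    Fintype.card_fin, smul_eq_mul]
  have := finrank_span_hook_le (K := K) T H v d e (c * (2 * n))
  calc _ ≤ (d + e) * (c * (2 * n) + 1) + n * Module.finrank K E := by gcongr
    _ = _ := by ring

end IsIntegroDiffTriple

end Growth

end IntegroDiff

namespace IntegroDiff

/-! ### Finite length by comparison of growth. -/

section FiniteLength

variable {K R M : Type*} [Field K] [Ring R] [Algebra K R] [AddCommGroup M] [Module K M]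
  [Module R M] [IsScalarTower K R M]

namespace IsIntegroDiffTriple

variable {S T H : R} (h : IsIntegroDiffTriple K S T H)
include h

/-- An increasing filtration by finite-dimensional spaces which is raised by at most one by the
generators grows at least linearly. -/
theorem lt_finrank_of_filtration [CharZero K] (W : ℕ → Submodule K M)
    [∀ n, FiniteDimensional K (W n)] (hmono : Monotone W)
    (hS : ∀ n, ∀ x ∈ W n, S • x ∈ W (n + 1)) (hT : ∀ n, ∀ x ∈ W n, T • x ∈ W (n + 1))
    (hH : ∀ n, ∀ x ∈ W n, H • x ∈ W (n + 1)) {s : ℕ} (hs : W s ≠ ⊥) (n : ℕ) :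
    n < Module.finrank K (W (s + n)) := by
  induction n with
  | zero =>
    rw [Module.finrank_pos_iff, Submodule.nontrivial_iff_ne_bot]
    exact hs
  | succ n ih =>
    by_contra! hle
    -- If the dimension stalls, this space is stable under the generators and therefore zero.
    have heq : W (s + n) = W (s + n + 1) :=
      Submodule.eq_of_le_of_finrank_le (hmono (Nat.le_succ _)) (by rw [← add_assoc] at hle; omega)
    have hbot := h.eq_bot_of_stable (W (s + n)) (fun x hx => heq ▸ hS _ x hx)
      (fun x hx => heq ▸ hT _ x hx) (fun x hx => heq ▸ hH _ x hx)
    exact hs (le_bot_iff.mp (hbot ▸ hmono (Nat.le_add_right s n)))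

/-- The images of N' ∩ level in M / N form a filtration to which `lt_finrank_of_filtration` applies;
the kernels contain N ∩ level. -/
theorem finrank_inf_level_lt [CharZero K] {v : M}
    (hfin : ∀ n, FiniteDimensional K (level K T H v n)) {N N' : Submodule R M} (hN : N ≤ N')
    {s : ℕ} {x : M} (hx : x ∈ level K T H v s) (hxN' : x ∈ N') (hxN : x ∉ N) (n : ℕ) :
    Module.finrank K (N.restrictScalars K ⊓ level K T H v (s + n) : Submodule K M) + n <
      Module.finrank K (N'.restrictScalars K ⊓ level K T H v (s + n) : Submodule K M) := by
  let W : ℕ → Submodule K M := fun n => N'.restrictScalars K ⊓ level K T H v n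
  let π : M →ₗ[K] M ⧸ N := N.mkQ.restrictScalars K
  have hW : ∀ n, FiniteDimensional K (W n) := fun n =>
    Submodule.finiteDimensional_of_le (inf_le_right : W n ≤ level K T H v n)
  have hstep : ∀ (a : R), (∀ n, ∀ x ∈ level K T H v n, a • x ∈ level K T H v (n + 1)) →
      ∀ n, ∀ x ∈ (W n).map π, a • x ∈ (W (n + 1)).map π := by
    rintro a ha n _ ⟨x, hx, rfl⟩
    exact ⟨a • x, ⟨N'.smul_mem a hx.1, ha n x hx.2⟩, N.mkQ.map_smul a x⟩
  have hlt := h.lt_finrank_of_filtration (fun n => (W n).map π)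
    (fun i j hij => Submodule.map_mono (inf_le_inf_left _ (h.level_mono v hij)))
    (hstep S fun n x hx => h.S_smul_mem_level hx) (hstep T fun n x hx => h.T_smul_mem_level hx)
    (hstep H fun n x hx => h.H_smul_mem_level hx) (s := s) (by
      intro hbot
      have : π x ∈ (W s).map π := ⟨x, ⟨hxN', hx⟩, rfl⟩
      rw [hbot, Submodule.mem_bot] at this
      exact hxN ((Submodule.Quotient.mk_eq_zero N).mp this)) n
  have hrn := (π.domRestrict (W (s + n))).finrank_range_add_finrank_ker
  rw [LinearMap.range_domRestrict] at hrn
  have hker : Module.finrank K (N.restrictScalars K ⊓ level K T H v (s + n) : Submodule K M) ≤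
      Module.finrank K (LinearMap.ker (π.domRestrict (W (s + n)))) := by
    have hmem : ∀ y : (N.restrictScalars K ⊓ level K T H v (s + n) : Submodule K M),
        (y : M) ∈ W (s + n) := fun y => ⟨hN y.2.1, y.2.2⟩
    let φ : (N.restrictScalars K ⊓ level K T H v (s + n) : Submodule K M) →ₗ[K]
        LinearMap.ker (π.domRestrict (W (s + n))) :=
      ((Submodule.subtype _).codRestrict (W (s + n)) hmem).codRestrict _ fun y =>
        (Submodule.Quotient.mk_eq_zero N).mpr y.2.1
    refine LinearMap.finrank_le_finrank_of_injective (f := φ) fun y z hyz => ?_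
    have hval : ((φ y : W (s + n)) : M) = ((φ z : W (s + n)) : M) := by rw [hyz]
    exact Subtype.ext hval
  change _ < Module.finrank K (W (s + n))
  omega

/-- A cyclic module annihilated by an element outside `finiteRank K S T` has finite length. -/
theorem isFiniteLength [CharZero K] {v : M} (hv : ∀ x : M, ∃ r : R, r • v = x)
    {a : R} (ha : a ∉ finiteRank K S T) (hav : a • v = 0) : IsFiniteLength R M := by
  obtain ⟨C, D, hCD⟩ := h.exists_finrank_level_le hv ha hav
  rw [← Module.length_ne_top_iff, Ne, Module.length_eq_top_iff_infiniteDimensionalOrder]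
  intro hinf
  let p := LTSeries.withLength (Submodule R M) (C + 1)
  have hlen : p.length = C + 1 := LTSeries.length_withLength ..
  have hex : ∀ i : Fin p.length, ∃ s x, x ∈ level K T H v s ∧ x ∈ p i.succ ∧ x ∉ p i.castSucc := by
    intro i
    obtain ⟨x, hx, hx'⟩ := SetLike.exists_of_lt (show p i.castSucc < p i.succ from p.step i)
    obtain ⟨r, rfl⟩ := hv x
    obtain ⟨s, hs⟩ := h.exists_mem_level v r
    exact ⟨s, _, hs, hx, hx'⟩
  choose σ x hσ hx hx' using hex
  let s := Finset.univ.sup σ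
  have hσ' : ∀ i, x i ∈ level K T H v s := fun i =>
    h.level_mono v (Finset.le_sup (Finset.mem_univ i)) (hσ i)
  -- Each strict inclusion in the chain contributes at least n + 1 dimensions.
  have hgrow : ∀ n i (hi : i < p.length + 1), i * (n + 1) ≤ Module.finrank K
      ((p ⟨i, hi⟩).restrictScalars K ⊓ level K T H v (s + n) : Submodule K M) := by
    intro n i
    induction i with
    | zero => simp
    | succ i ih =>
      intro hi
      have hi' : i < p.length := by omega
      have h1 := ih (by omega)
      have hlt : p (Fin.castSucc ⟨i, hi'⟩) < p (Fin.succ ⟨i, hi'⟩) := p.step ⟨i, hi'⟩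
      have h2 := h.finrank_inf_level_lt (fun n => (hCD n).1) hlt.le (hσ' ⟨i, hi'⟩) (hx _) (hx' _) n
      change _ < Module.finrank K
        ((p ⟨i + 1, hi⟩).restrictScalars K ⊓ level K T H v (s + n) : Submodule K M) at h2
      refine le_trans ?_ h2
      rw [add_mul, one_mul]
      exact Nat.add_le_add_right h1 _
  -- The two bounds give (C + 1) * (n + 1) ≤ C * (s + n) + D, which this n violates.
  obtain ⟨n, hn⟩ : ∃ n, n = C * s + D := ⟨_, rfl⟩
  have h1 := hgrow n p.length (by omega)
  have := (hCD (s + n)).1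
  have h2 := (Submodule.finrank_mono (inf_le_right :
    ((p ⟨p.length, by omega⟩).restrictScalars K ⊓ level K T H v (s + n) : Submodule K M) ≤ _)).trans
    (hCD (s + n)).2
  have h3 := h1.trans h2
  rw [hlen] at h3
  linarith

/-- Right multiplication by H is an injective endomorphism of R / F. If it were surjective, H would
have a left inverse modulo F, and comparing coefficients of T ^ n would make X + n a unit in K[X].
-/
theorem not_isArtinian_quotient [CharZero K] : ¬ IsArtinian R (R ⧸ h.finiteRankIdeal) := by
  intro hart
  have := h.isTwoSided_finiteRankIdeal
  have hshift : ∀ (s : Finset ℕ) (f : ℕ → K[X]),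
      (∑ j ∈ s, aeval H (f j) * T ^ j) * H =
        ∑ j ∈ s, aeval H (f j * (X + C (j : K))) * T ^ j := by
    intro s f
    rw [Finset.sum_mul]
    refine Finset.sum_congr rfl fun j _ => ?_
    rw [mul_assoc, h.T_pow_mul_H, map_mul, map_add, aeval_X, aeval_C, mul_assoc, add_mul,
      ← Algebra.smul_def]
  let φ : (R ⧸ h.finiteRankIdeal) →ₗ[R] (R ⧸ h.finiteRankIdeal) :=
    h.finiteRankIdeal.mapQ h.finiteRankIdeal (LinearMap.toSpanSingleton R R H)
      fun x hx => h.mul_mem_finiteRank_right H hx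
  have hinj : Function.Injective φ := by
    rw [← LinearMap.ker_eq_bot, LinearMap.ker_eq_bot']
    intro x hx
    obtain ⟨r, rfl⟩ := Submodule.Quotient.mk_surjective _ x
    have hr : r * H ∈ finiteRank K S T := (Submodule.Quotient.mk_eq_zero _).mp hx
    obtain ⟨n, f, hf⟩ := h.exists_T_pow_mul_eq_sum r
    have hr2 := h.mul_mem_finiteRank_left (T ^ n) hr
    rw [← mul_assoc, hf, hshift] at hr2
    have hzero := h.eq_zero_of_sum_mem_finiteRank hr2
    rw [Submodule.Quotient.mk_eq_zero, mem_finiteRankIdeal]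
    refine h.mem_finiteRank_of_T_pow_mul_eq_zero (n := n) ?_
    rw [hf]
    refine Finset.sum_eq_zero fun j hj => ?_
    rw [(mul_eq_zero.mp (hzero j hj)).resolve_right (X_add_C_ne_zero _), map_zero, zero_mul]
  obtain ⟨x, hx⟩ := IsArtinian.surjective_of_injective_endomorphism φ hinj
    (Submodule.Quotient.mk 1)
  obtain ⟨r, rfl⟩ := Submodule.Quotient.mk_surjective _ x
  have hr : r * H - 1 ∈ finiteRank K S T := (Submodule.Quotient.eq _).mp hx
  obtain ⟨n, f, hf⟩ := h.exists_T_pow_mul_eq_sum r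
  have hr2 := h.mul_mem_finiteRank_left (T ^ n) hr
  have hTn : T ^ n = ∑ j ∈ Finset.range (2 * n + 1),
      aeval H (if j = n then (1 : K[X]) else 0) * T ^ j := by
    rw [Finset.sum_eq_single n]
    · simp
    · intro j _ hj
      simp [hj]
    · intro hn
      simp at hn
      omega
  have hsub : T ^ n * (r * H - 1) = ∑ j ∈ Finset.range (2 * n + 1),
      aeval H (f j * (X + C (j : K)) - if j = n then (1 : K[X]) else 0) * T ^ j := by
    simp only [map_sub, sub_mul, Finset.sum_sub_distrib]
    rw [← hTn, ← hshift, ← hf, mul_sub, mul_one, mul_assoc]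
  rw [hsub] at hr2
  have hzero := h.eq_zero_of_sum_mem_finiteRank hr2 n (by simp; omega)
  have := congrArg (eval (-(n : K))) hzero
  simp at this

end IsIntegroDiffTriple

end FiniteLength

/-! ### Cyclicity of finite length modules and generators of left ideals. -/

section Cyclic

variable {K R M : Type*} [Field K] [Ring R] [Algebra K R] [AddCommGroup M] [Module R M]

namespace IsIntegroDiffTriple

variable {S T H : R} (h : IsIntegroDiffTriple K S T H)
include h

/-- If the annihilator of m lay in F, then R / F would be a quotient of the Artinian module R m. -/
theorem exists_smul_eq_zero [CharZero K] [IsArtinian R M] (m : M) :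
    ∃ l : R, l ∉ finiteRank K S T ∧ l • m = 0 := by
  by_contra! hall
  refine h.not_isArtinian_quotient ?_
  let φ := LinearMap.toSpanSingleton R M m
  have hker : LinearMap.ker φ ≤ h.finiteRankIdeal := by
    intro l hl
    by_contra hl'
    exact hall l hl' hl
  have : IsArtinian R (R ⧸ LinearMap.ker φ) :=
    isArtinian_of_linearEquiv φ.quotKerEquivRange.symm
  exact isArtinian_of_surjective _ (Submodule.factor hker) (Submodule.factor_surjective hker)

/-- Modulo `N`, no nonzero `N'` is killed by an element outside `finiteRank K S T`. -/
theorem exists_smul_notMem [CharZero K] {N N' : Submodule R M} (hN : ¬ N' ≤ N) {l : R}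
    (hl : l ∉ finiteRank K S T) : ∃ x ∈ N', ∃ r : R, (l * r) • x ∉ N := by
  by_contra! hall
  obtain ⟨n, d, f, hd, hf⟩ := h.exists_relation hl
  -- The elements a with a R N' ⊆ N form a two-sided ideal; since it contains l, it contains 1.
  let J : Ideal R :=
    { carrier := {a | ∀ r : R, ∀ x ∈ N', (a * r) • x ∈ N}
      add_mem' := fun {a b} ha hb r x hx => by
        rw [add_mul, add_smul]
        exact N.add_mem (ha r x hx) (hb r x hx)
      zero_mem' := fun r x _ => by simp
      smul_mem' := fun c a ha r x hx => by
        rw [smul_eq_mul, mul_assoc, mul_smul]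
        exact N.smul_mem c (ha r x hx) }
  have : J.IsTwoSided := ⟨fun {a} b ha r x hx => by
    rw [mul_assoc]
    exact ha (b * r) x hx⟩
  have hlJ : l ∈ J := fun r x hx => hall x hx r
  have hsum := J.mul_mem_left (T ^ n) hlJ
  classical
  have hone : (1 : R) ∈ J := by
    refine h.one_mem_of_sum_mem J (s := (Finset.range (d + 1)).filter fun i => f i ≠ 0)
      ⟨d, by simp [hd]⟩ f (by simp) ?_
    rw [Finset.sum_filter_of_ne]
    · rwa [← hf]
    · rintro j _ hj h0
      simp [h0] at hj
  refine hN fun x hx => ?_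
  simpa using hone 1 x hx

/-- Modules of finite length are cyclic. -/
theorem exists_span_singleton_eq_top [CharZero K] [IsArtinian R M] [IsNoetherian R M] :
    ∃ m : M, Submodule.span R {m} = ⊤ := by
  suffices hsup : ∀ N : Submodule R M, ∃ m : M, N ⊔ Submodule.span R {m} = ⊤ by
    simpa using hsup ⊥
  intro N
  induction N using WellFoundedGT.induction with
  | ind N ih =>
    rcases eq_or_ne N ⊤ with rfl | hN
    · exact ⟨0, by simp⟩
    obtain ⟨N', hcov, -⟩ := exists_covBy_le_of_lt hN.lt_top
    obtain ⟨m, hm⟩ := ih N' hcov.lt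
    by_cases htop : N ⊔ Submodule.span R {m} = ⊤
    · exact ⟨m, htop⟩
    -- Here m generates modulo N', which covers N. As l kills m, applying l to the corrected element
    -- m + r • x leaves (l * r) • x ∈ N' \ N, so the new submodule absorbs N' and then m.
    obtain ⟨l, hl, hlm⟩ := h.exists_smul_eq_zero m
    obtain ⟨x, hx, r, hlx⟩ := h.exists_smul_notMem hcov.lt.not_ge hl
    refine ⟨m + r • x, ?_⟩
    set P := N ⊔ Submodule.span R {m + r • x}
    have hmem : m + r • x ∈ P :=
      Submodule.mem_sup_right (Submodule.mem_span_singleton_self _)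
    have hlP : (l * r) • x ∈ P := by
      have := P.smul_mem l hmem
      rwa [smul_add, hlm, zero_add, ← mul_smul] at this
    have hle : N' ≤ P := by
      have hlt : N < N' ⊓ P := by
        refine lt_of_le_of_ne (le_inf hcov.le le_sup_left) fun heq => hlx ?_
        rw [heq]
        exact ⟨N'.smul_mem _ hx, hlP⟩
      exact inf_eq_left.mp ((hcov.eq_or_eq hlt.le inf_le_left).resolve_left hlt.ne')
    rw [eq_top_iff, ← hm]
    refine sup_le hle ?_
    rw [Submodule.span_singleton_le_iff_mem]
    have := P.sub_mem hmem (hle (N'.smul_mem r hx))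
    rwa [add_sub_cancel_right] at this

/-- A left ideal not contained in `finiteRank K S T` is generated by two elements. -/
theorem exists_eq_span_pair [CharZero K] {I : Submodule R R}
    (hI : ¬ (I : Set R) ⊆ finiteRank K S T) : ∃ a b : R, I = Submodule.span R {a, b} := by
  obtain ⟨a, haI, ha⟩ := Set.not_subset.mp hI
  let N := Submodule.span R {a}
  have hfl : IsFiniteLength R (R ⧸ N) := by
    refine h.isFiniteLength (v := N.mkQ 1) (fun x => ?_) ha ?_
    · obtain ⟨r, rfl⟩ := N.mkQ_surjective x
      exact ⟨r, by rw [← map_smul, smul_eq_mul, mul_one]⟩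
    · rw [← map_smul, smul_eq_mul, mul_one]
      exact (Submodule.Quotient.mk_eq_zero N).mpr (Submodule.mem_span_singleton_self a)
  obtain ⟨_, _⟩ := isFiniteLength_iff_isNoetherian_isArtinian.mp hfl
  obtain ⟨⟨y, b, hb, rfl⟩, hy⟩ := h.exists_span_singleton_eq_top (M := I.map N.mkQ)
  refine ⟨a, b, le_antisymm (fun x hx => ?_) ?_⟩
  · have hx' : (⟨N.mkQ x, x, hx, rfl⟩ : I.map N.mkQ) ∈ Submodule.span R {⟨N.mkQ b, b, hb, rfl⟩} := by
      rw [hy]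
      exact Submodule.mem_top
    obtain ⟨r, hr⟩ := Submodule.mem_span_singleton.mp hx'
    have hr' : N.mkQ (r • b) = N.mkQ x := by
      rw [map_smul]
      exact congrArg Subtype.val hr
    have hsub := (Submodule.Quotient.eq N).mp hr'
    obtain ⟨c, hc⟩ := Submodule.mem_span_singleton.mp hsub
    rw [Submodule.mem_span_pair]
    exact ⟨-c, r, by rw [neg_smul, hc]; abel⟩
  · rw [Submodule.span_le]
    rintro x (rfl | rfl)
    exacts [haI, hb]

/-- A finitely generated left ideal contained in `finiteRank K S T` is principal. -/
theorem exists_eq_span_singleton {I : Submodule R R}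
    (hI : (I : Set R) ⊆ finiteRank K S T) (hfg : I.FG) : ∃ a : R, I = Submodule.span R {a} := by
  obtain ⟨k, f, hf⟩ := Submodule.fg_iff_exists_fin_generating_family.mp hfg
  have hfI : ∀ i, f i ∈ I := fun i => hf ▸ Submodule.subset_span ⟨i, rfl⟩
  have hex : ∀ i, ∃ n, T ^ n * f i = 0 := fun i => h.exists_T_pow_mul_eq_zero (hI (hfI i))
  choose ν hν using hex
  let n := Finset.univ.sup ν
  have hn : ∀ i, T ^ n * f i = 0 := by
    intro i
    obtain ⟨c, hc⟩ := Nat.exists_eq_add_of_le' (Finset.le_sup (f := ν) (Finset.mem_univ i))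
    change T ^ (Finset.univ.sup ν) * f i = 0
    rw [hc, pow_add, mul_assoc, hν, mul_zero]
  -- The index t = n * i + j encodes generator i and component j; out of range the value is 0.
  let g : ℕ → R := fun t => (1 - S * T) * T ^ (t % n) *
    if ht : t / n < k then f ⟨t / n, ht⟩ else 0
  have hgI : ∀ t, g t ∈ I := by
    intro t
    refine I.smul_mem _ ?_
    split_ifs
    exacts [hfI _, I.zero_mem]
  have hT : ∀ t, T * g t = 0 := fun t => by
    simp only [g]
    rw [← mul_assoc, ← mul_assoc, h.T_mul_proj, zero_mul, zero_mul]
  have hproj : ∀ t, (1 - S * T) * g t = g t := fun t => by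
    rw [sub_mul, one_mul, mul_assoc, hT, mul_zero, sub_zero]
  refine ⟨∑ t ∈ Finset.range (k * n), S ^ t * g t, le_antisymm ?_ ?_⟩
  · set a := ∑ t ∈ Finset.range (k * n), S ^ t * g t with ha
    have hga : ∀ t < k * n, g t ∈ Submodule.span R {a} := by
      intro t ht
      rw [Submodule.mem_span_singleton]
      -- This isolates g t: for s < t a surplus T kills g s, and for s > t a surplus S is killed by
      -- 1 - S * T.
      refine ⟨(1 - S * T) * T ^ t, ?_⟩
      rw [smul_eq_mul, ha, Finset.mul_sum, Finset.sum_eq_single t]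
      · rw [mul_assoc, ← mul_assoc (T ^ t), h.T_pow_mul_S_pow, one_mul, hproj]
      · intro s _ hst
        rcases lt_or_gt_of_ne hst with hlt | hlt
        · obtain ⟨c, rfl⟩ := Nat.exists_eq_add_of_lt hlt
          have : T ^ (s + c + 1) = T ^ c * T * T ^ s := by
            rw [← pow_succ, ← pow_add]
            congr 1
            omega
          rw [this, mul_assoc, ← mul_assoc (T ^ c * T * T ^ s), mul_assoc (T ^ c * T),
            h.T_pow_mul_S_pow, mul_one, mul_assoc, hT, mul_zero, mul_zero]
        · obtain ⟨c, rfl⟩ := Nat.exists_eq_add_of_lt hlt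
          have : S ^ (t + c + 1) = S ^ t * (S * S ^ c) := by
            rw [← pow_succ', ← pow_add, add_assoc]
          rw [this, ← mul_assoc, mul_assoc (1 - S * T), ← mul_assoc (T ^ t),
            h.T_pow_mul_S_pow, one_mul, ← mul_assoc (1 - S * T) S, h.proj_mul_S, zero_mul, zero_mul]
      · intro hn'
        exact absurd (Finset.mem_range.mpr ht) hn'
    rw [← hf, Submodule.span_le]
    rintro _ ⟨i, rfl⟩
    have hsum : f i = ∑ j ∈ Finset.range n, S ^ j * ((1 - S * T) * T ^ j * f i) := by
      conv_lhs => rw [← one_mul (f i), eq_sum_add S T n, add_mul, mul_assoc (S ^ n), hn, mul_zero,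
        add_zero, Finset.sum_mul]
      simp only [mul_assoc]
    rw [hsum]
    refine Submodule.sum_mem _ fun j hj => ?_
    rw [Finset.mem_range] at hj
    have hpos : 0 < n := by omega
    have hg : (1 - S * T) * T ^ j * f i = g (n * i + j) := by
      have h1 : (n * i + j) % n = j := by rw [Nat.mul_add_mod, Nat.mod_eq_of_lt hj]
      have h2 : (n * i + j) / n = i := by
        rw [Nat.mul_add_div hpos, Nat.div_eq_of_lt hj, add_zero]
      simp only [g, h1, h2, i.2, dite_true]
    rw [hg]
    refine Submodule.smul_mem _ (S ^ j) (hga _ ?_)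
    calc n * i + j < n * (i + 1) := by rw [mul_add]; omega
      _ ≤ k * n := by rw [mul_comm k]; exact Nat.mul_le_mul_left n i.2
  · rw [Submodule.span_singleton_le_iff_mem]
    exact I.sum_mem fun t _ => I.smul_mem _ (hgI t)

end IsIntegroDiffTriple

end Cyclic

end IntegroDiff

namespace IntegroDiff

/-! ### Passage to the opposite ring. -/

section Opposite

open MulOpposite

variable {K R : Type*} [Field K] [Ring R] [Algebra K R]

theorem finiteRank_op (S T : R) :
    finiteRank K (op T) (op S) = (finiteRank K S T).map (opLinearEquiv K : R ≃ₗ[K] Rᵐᵒᵖ).toLinearMap := by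
  rw [finiteRank, finiteRank, Submodule.map_span, ← Set.range_comp]
  congr 1
  refine (Prod.swap_surjective.range_comp _).symm.trans (congrArg Set.range (funext fun p => ?_))
  simp [mul_assoc]

theorem op_mem_finiteRank {S T x : R} :
    op x ∈ finiteRank K (op T) (op S) ↔ x ∈ finiteRank K S T := by
  rw [finiteRank_op]
  exact (opLinearEquiv K : R ≃ₗ[K] Rᵐᵒᵖ).injective.mem_set_image (s := finiteRank K S T)

theorem pow_mul_one_sub_mul_mul_pow (S T : R) (i j : ℕ) :
    S ^ i * (1 - S * T) * T ^ j = S ^ i * T ^ j - S ^ (i + 1) * T ^ (j + 1) := by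
  rw [mul_sub, sub_mul, mul_one, pow_succ, pow_succ']
  simp only [mul_assoc]

/-- The ring and its opposite are isomorphic right modules. -/
def opRightEquiv (R : Type*) [Ring R] : R ≃ₗ[Rᵐᵒᵖ] Rᵐᵒᵖ where
  toFun := op
  invFun := unop
  left_inv _ := rfl
  right_inv _ := rfl
  map_add' _ _ := rfl
  map_smul' _ _ := rfl

namespace IsIntegroDiffTriple

variable {S T H : R} (h : IsIntegroDiffTriple K S T H)
include h

theorem opposite : IsIntegroDiffTriple K (op T) (op S) (op H) where
  mul_eq_one := by rw [← op_mul, h.mul_eq_one, op_one]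
  mul_mul_eq := by rw [mul_assoc, ← op_mul, ← op_mul, h.mul_mul_eq, op_sub, op_one]
  adjoin_eq_top := by
    have : ({op T, op S, op H} : Set Rᵐᵒᵖ) = unop ⁻¹' {S, T, H} := by
      ext x
      simp only [Set.mem_insert_iff, Set.mem_singleton_iff, Set.mem_preimage, ← unop_inj,
        unop_op]
      tauto
    rw [this, ← Subalgebra.op_adjoin, h.adjoin_eq_top, Subalgebra.op_top]
  one_notMem := by
    rw [← op_one, op_mem_finiteRank]
    exact h.one_notMem

theorem exists_eq_span_pair_right [CharZero K] {I : Submodule Rᵐᵒᵖ R}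
    (hI : ¬ (I : Set R) ⊆ finiteRank K S T) : ∃ a b : R, I = Submodule.span Rᵐᵒᵖ {a, b} := by
  obtain ⟨a, b, hab⟩ := h.opposite.exists_eq_span_pair
    (I := I.map (opRightEquiv R).toLinearMap) fun hsub =>
      hI fun x hx => op_mem_finiteRank.mp (hsub ⟨x, hx, rfl⟩)
  refine ⟨unop a, unop b, ?_⟩
  apply Submodule.map_injective_of_injective (opRightEquiv R).injective
  rw [Submodule.map_span, Set.image_pair]
  exact hab

theorem exists_eq_span_singleton_right {I : Submodule Rᵐᵒᵖ R}
    (hI : (I : Set R) ⊆ finiteRank K S T) (hfg : I.FG) :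
    ∃ a : R, I = Submodule.span Rᵐᵒᵖ {a} := by
  obtain ⟨a, ha⟩ := h.opposite.exists_eq_span_singleton
    (I := I.map (opRightEquiv R).toLinearMap)
    (by rintro _ ⟨x, hx, rfl⟩; exact op_mem_finiteRank.mpr (hI hx)) (hfg.map _)
  refine ⟨unop a, ?_⟩
  apply Submodule.map_injective_of_injective (opRightEquiv R).injective
  rw [Submodule.map_span, Set.image_singleton]
  exact ha

end IsIntegroDiffTriple

end Opposite

/-! ### Verification of the relations for polynomial integro-differential operators. -/

section Concrete

variable (K : Type*) [Field K]

theorem integration_monomial (n : ℕ) (c : K) :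
    integration K (monomial n c) = monomial (n + 1) (((n : K) + 1)⁻¹ * c) := by
  simp [integration, Polynomial.lsum_apply, smul_monomial]

/-- Multiplication by the variable, as an element of the algebra. -/
noncomputable def mulX : I1 K :=
  ⟨LinearMap.mulLeft K (X : K[X]), Algebra.subset_adjoin (by simp)⟩

theorem integ_apply_monomial (n : ℕ) (c : K) :
    (integ K : Module.End K K[X]) (monomial n c) = monomial (n + 1) (((n : K) + 1)⁻¹ * c) :=
  integration_monomial K n c

theorem der_apply_monomial (n : ℕ) (c : K) :
    (der K : Module.End K K[X]) (monomial n c) = monomial (n - 1) (c * n) :=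
  derivative_monomial c n

theorem mulX_apply_monomial (n : ℕ) (c : K) :
    (mulX K : Module.End K K[X]) (monomial n c) = monomial (n + 1) c := by
  change X * monomial n c = _
  rw [X_mul_monomial]

variable {K} in
theorem ext_monomial {a b : I1 K}
    (hab : ∀ n c, (a : Module.End K K[X]) (monomial n c) = (b : Module.End K K[X]) (monomial n c)) :
    a = b :=
  Subtype.ext (Polynomial.lhom_ext' fun n => LinearMap.ext fun c => hab n c)

variable [CharZero K]

theorem der_mul_integ : der K * integ K = 1 := by
  refine ext_monomial fun n c => ?_
  have hn : (n : K) + 1 ≠ 0 := Nat.cast_add_one_ne_zero n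
  change (der K : Module.End K K[X]) ((integ K : Module.End K K[X]) (monomial n c)) = monomial n c
  rw [integ_apply_monomial, der_apply_monomial]
  congr 1
  push_cast
  field_simp

/-- ∫∂ fixes polynomials without constant term. This identity also recovers x from ∫ and ∂x. -/
theorem integ_mul_der_mul_mulX : integ K * (der K * mulX K) = mulX K := by
  refine ext_monomial fun n c => ?_
  have hn : (n : K) + 1 ≠ 0 := Nat.cast_add_one_ne_zero n
  change (integ K : Module.End K K[X]) ((der K : Module.End K K[X])
    ((mulX K : Module.End K K[X]) (monomial n c))) = _
  rw [mulX_apply_monomial, der_apply_monomial, Nat.add_sub_cancel, integ_apply_monomial]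
  congr 1
  push_cast
  field_simp

theorem der_mul_mulX : der K * mulX K = mulX K * der K + 1 := by
  refine ext_monomial fun n c => ?_
  change (der K : Module.End K K[X]) ((mulX K : Module.End K K[X]) (monomial n c)) =
    (mulX K : Module.End K K[X]) ((der K : Module.End K K[X]) (monomial n c)) + monomial n c
  rw [mulX_apply_monomial, der_apply_monomial, der_apply_monomial, mulX_apply_monomial]
  cases n with
  | zero => simp
  | succ n =>
    rw [Nat.add_sub_cancel, Nat.add_sub_cancel, ← map_add]
    congr 1
    push_cast
    ring

omit [CharZero K] in
theorem finiteRank_eq_F : finiteRank K (integ K) (der K) = F K := by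
  rw [finiteRank, F]
  congr 2
  funext p
  exact pow_mul_one_sub_mul_mul_pow (integ K) (der K) p.1 p.2

/-- Every element of F kills x ^ n for all large n: if n > j, then ∂ ^ j sends x ^ n to a multiple
of a positive power of x, which 1 - ∫∂ annihilates. -/
theorem one_notMem_finiteRank : (1 : I1 K) ∉ finiteRank K (integ K) (der K) := by
  suffices hkill : ∀ x ∈ finiteRank K (integ K) (der K),
      ∃ N, ∀ n ≥ N, (x : Module.End K K[X]) (monomial n 1) = 0 by
    intro hone
    obtain ⟨N, hN⟩ := hkill 1 hone
    exact one_ne_zero ((monomial_eq_zero_iff (1 : K) N).mp (hN N le_rfl))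
  have hder : ∀ j n : ℕ, j ≤ n → ∀ c : K, ∃ c', ((der K ^ j : I1 K) : Module.End K K[X])
      (monomial n c) = monomial (n - j) c' := by
    intro j
    induction j with
    | zero => exact fun n _ c => ⟨c, rfl⟩
    | succ j ih =>
      intro n hn c
      obtain ⟨c', hc'⟩ := ih (n - 1) (by omega) (c * n)
      refine ⟨c', ?_⟩
      rw [pow_succ]
      change ((der K ^ j : I1 K) : Module.End K K[X])
        ((der K : Module.End K K[X]) (monomial n c)) = _
      rw [der_apply_monomial, hc', Nat.sub_sub, add_comm 1 j]
  have hproj : ∀ (n : ℕ) (c : K), ((1 - integ K * der K : I1 K) : Module.End K K[X])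
      (monomial (n + 1) c) = 0 := by
    intro n c
    have hn : (n : K) + 1 ≠ 0 := Nat.cast_add_one_ne_zero n
    change monomial (n + 1) c - (integ K : Module.End K K[X])
      ((der K : Module.End K K[X]) (monomial (n + 1) c)) = 0
    rw [der_apply_monomial, Nat.add_sub_cancel, integ_apply_monomial, ← map_sub,
      monomial_eq_zero_iff]
    push_cast
    field_simp
    ring
  intro x hx
  induction hx using Submodule.span_induction with
  | mem x hx =>
    obtain ⟨⟨i, j⟩, rfl⟩ := hx
    refine ⟨j + 1, fun n hn => ?_⟩
    obtain ⟨c', hc'⟩ := hder j n (by omega) 1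
    change ((integ K ^ i : I1 K) : Module.End K K[X])
      (((1 - integ K * der K : I1 K) : Module.End K K[X])
        (((der K ^ j : I1 K) : Module.End K K[X]) (monomial n 1))) = 0
    obtain ⟨m, hm⟩ := Nat.exists_eq_add_of_le' (show 1 ≤ n - j by omega)
    rw [hc', hm, hproj, map_zero]
  | zero => exact ⟨0, fun n _ => rfl⟩
  | add x y _ _ hx hy =>
    obtain ⟨N, hN⟩ := hx
    obtain ⟨N', hN'⟩ := hy
    refine ⟨max N N', fun n hn => ?_⟩
    change (x : Module.End K K[X]) (monomial n 1) + (y : Module.End K K[X]) (monomial n 1) = 0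
    rw [hN n (le_of_max_le_left hn), hN' n (le_of_max_le_right hn), add_zero]
  | smul c x _ hx =>
    obtain ⟨N, hN⟩ := hx
    refine ⟨N, fun n hn => ?_⟩
    change c • (x : Module.End K K[X]) (monomial n 1) = 0
    rw [hN n hn, smul_zero]

theorem isIntegroDiffTriple :
    IsIntegroDiffTriple K (integ K) (der K) (der K * mulX K) where
  mul_eq_one := der_mul_integ K
  mul_mul_eq := by
    rw [integ_mul_der_mul_mulX, der_mul_mulX]
    exact eq_sub_of_add_eq rfl
  adjoin_eq_top := by
    set A : Subalgebra K (I1 K) :=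
      Algebra.adjoin K {integ K, der K, der K * mulX K} with hA
    have hS : integ K ∈ A := Algebra.subset_adjoin (by simp)
    have hT : der K ∈ A := Algebra.subset_adjoin (by simp)
    have hH : der K * mulX K ∈ A := Algebra.subset_adjoin (by simp)
    rw [eq_top_iff]
    refine (Algebra.adjoin_adjoin_coe_preimage (R := K) (s := {LinearMap.mulLeft K (X : K[X]),
      Polynomial.derivative, integration K})).ge.trans (Algebra.adjoin_le ?_)
    rintro ⟨x, hx⟩ (rfl | rfl | rfl)
    · change mulX K ∈ A
      rw [← integ_mul_der_mul_mulX]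
      exact A.mul_mem hS hH
    · exact hT
    · exact hS
  one_notMem := one_notMem_finiteRank K

end Concrete

end IntegroDiff

open IntegroDiff in
/-- Left ideals are submodules over `I1 K`, right ideals are submodules over its opposite ring. -/
theorem theorem4p5 (K : Type*) [Field K] [CharZero K] :
    -- every finitely generated left (right) ideal is generated by two elements
    ((∀ I : Submodule (I1 K) (I1 K), I.FG →
        ∃ a b : I1 K, I = Submodule.span (I1 K) {a, b}) ∧
      (∀ I : Submodule (I1 K)ᵐᵒᵖ (I1 K), I.FG →
        ∃ a b : I1 K, I = Submodule.span (I1 K)ᵐᵒᵖ {a, b})) ∧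
    -- every left (right) ideal not contained in `F` is generated by two elements
    ((∀ I : Submodule (I1 K) (I1 K), ¬ ((I : Set (I1 K)) ⊆ (F K : Set (I1 K))) →
        ∃ a b : I1 K, I = Submodule.span (I1 K) {a, b}) ∧
      (∀ I : Submodule (I1 K)ᵐᵒᵖ (I1 K), ¬ ((I : Set (I1 K)) ⊆ (F K : Set (I1 K))) →
        ∃ a b : I1 K, I = Submodule.span (I1 K)ᵐᵒᵖ {a, b})) ∧
    -- every finitely generated left (right) ideal contained in `F` is principal
    ((∀ I : Submodule (I1 K) (I1 K), (I : Set (I1 K)) ⊆ (F K : Set (I1 K)) → I.FG →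
        ∃ a : I1 K, I = Submodule.span (I1 K) {a}) ∧
      (∀ I : Submodule (I1 K)ᵐᵒᵖ (I1 K), (I : Set (I1 K)) ⊆ (F K : Set (I1 K)) → I.FG →
        ∃ a : I1 K, I = Submodule.span (I1 K)ᵐᵒᵖ {a})) := by
  have h := isIntegroDiffTriple K
  have hl : ∀ I : Submodule (I1 K) (I1 K), ¬ ((I : Set (I1 K)) ⊆ (F K : Set (I1 K))) →
      ∃ a b : I1 K, I = Submodule.span (I1 K) {a, b} := fun I hI =>
    h.exists_eq_span_pair (by rwa [finiteRank_eq_F])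
  have hr : ∀ I : Submodule (I1 K)ᵐᵒᵖ (I1 K), ¬ ((I : Set (I1 K)) ⊆ (F K : Set (I1 K))) →
      ∃ a b : I1 K, I = Submodule.span (I1 K)ᵐᵒᵖ {a, b} := fun I hI =>
    h.exists_eq_span_pair_right (by rwa [finiteRank_eq_F])
  have hl' : ∀ I : Submodule (I1 K) (I1 K), (I : Set (I1 K)) ⊆ (F K : Set (I1 K)) → I.FG →
      ∃ a : I1 K, I = Submodule.span (I1 K) {a} := fun I hI =>
    h.exists_eq_span_singleton (by rwa [finiteRank_eq_F])
  have hr' : ∀ I : Submodule (I1 K)ᵐᵒᵖ (I1 K), (I : Set (I1 K)) ⊆ (F K : Set (I1 K)) → I.FG →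
      ∃ a : I1 K, I = Submodule.span (I1 K)ᵐᵒᵖ {a} := fun I hI =>
    h.exists_eq_span_singleton_right (by rwa [finiteRank_eq_F])
  refine ⟨⟨fun I hfg => ?_, fun I hfg => ?_⟩, ⟨hl, hr⟩, ⟨hl', hr'⟩⟩
  · by_cases hI : (I : Set (I1 K)) ⊆ (F K : Set (I1 K))
    · obtain ⟨a, ha⟩ := hl' I hI hfg
      exact ⟨a, a, by rw [Set.pair_eq_singleton, ha]⟩
    · exact hl I hI
  · by_cases hI : (I : Set (I1 K)) ⊆ (F K : Set (I1 K))
    · obtain ⟨a, ha⟩ := hr' I hI hfg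
      exact ⟨a, a, by rw [Set.pair_eq_singleton, ha]⟩
    · exact hr I hI
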